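/- Lemma. Let $(S,\mathfrak m)$ be a Noetherian local ring (for example an excellent local ring), let $N$ be a finitely generated $S$-module, and let $f\in\mathfrak m$ be a nonzerodivisor on $S$ and on $N$. Put $R=S/(f)$ and $M=N/fN$, and let $n\ge 0$ be an integer. A finitely generated module $L$ over a Noetherian local ring $A$ is called free in codimension $n$ if $L_p$ is a free $A_p$-module for every prime $p$ of $A$ of codimension $\dim A-\dim A/p\le n$, and $L$ satisfies $(S_n)$ if $\operatorname{depth} L_p\ge\min\{n,\dim A_p\}$ for every prime $p$ of $A$ (with $\operatorname{depth} 0=\infty$). (1) If the $R$-module $M$ is free in codimension $n$, then the $S$-module $N$ is free in codimension $n$. If $S$ is catenary (for example excellent) and equidimensional ($\dim S/p=\dim S$ for every minimal prime $p$), then the same implication also holds when the codimension of a prime is understood as its height: if $M_q$ is free over $R_q$ for all primes $q$ of $R$ of height at most $n$, then $N_p$ is free over $S_p$ for all primes $p$ of $S$ of height at most $n$. (2) If the $R$-module $M$ satisfies $(S_n)$, then the $S$-module $N$ satisfies $(S_n)$. (3) If $K$ is a finitely generated $S$-module such that $f$ is a nonzerodivisor on $K$ and $\operatorname{Ext}^1_R(M,K/fK)=0$,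 then $\operatorname{Ext}^1_S(N,K)=0$, and reduction modulo $f$ induces an isomorphism of $R$-modules $\operatorname{Hom}_S(N,K)/f\operatorname{Hom}_S(N,K)\cong\operatorname{Hom}_R(M,K/fK)$. -/

import Mathlib

universe u

open scoped Pointwise

/-- The depth of a module over a local ring: the supremum of the lengths of the sequences of
elements of the maximal ideal that are weakly regular on the module. For a nonzero finite module
over a Noetherian local ring weakly regular sequences in the maximal ideal are regular, by
Nakayama's lemma; the zero module has depth `⊤`. -/
noncomputable def moduleDepth (A : Type*) [CommRing A] [IsLocalRing A]
    (M : Type*) [AddCommGroup M] [Module A M] : ℕ∞ :=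
  ⨆ (rs : List A) (_ : ∀ r ∈ rs, r ∈ IsLocalRing.maximalIdeal A)
    (_ : RingTheory.Sequence.IsWeaklyRegular M rs), (rs.length : ℕ∞)

/-- Serre's condition `(S_n)`: `depth M_p ≥ min {n, dim A_p}` for all primes `p` of `A`. -/
def SatisfiesSerre (A : Type*) [CommRing A] (M : Type*) [AddCommGroup M] [Module A M]
    (n : ℕ) : Prop :=
  ∀ (p : Ideal A) [p.IsPrime],
    min (n : WithBot ℕ∞) (ringKrullDim (Localization.AtPrime p)) ≤
      (moduleDepth (Localization.AtPrime p) (LocalizedModule p.primeCompl M) : WithBot ℕ∞)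

/-- `M` is free in codimension `n`: `M_p` is a free `A_p`-module for every prime `p` whose
codimension `dim A - dim A/p` is at most `n`. -/
def IsFreeInCodimension (A : Type*) [CommRing A] (M : Type*) [AddCommGroup M] [Module A M]
    (n : ℕ) : Prop :=
  ∀ (p : Ideal A) [p.IsPrime], ringKrullDim A ≤ ringKrullDim (A ⧸ p) + (n : WithBot ℕ∞) →
    Module.Free (Localization.AtPrime p) (LocalizedModule p.primeCompl M)

/-- `M_p` is a free `A_p`-module for every prime `p` of height at most `n`. -/
def IsFreeUpToHeight (A : Type*) [CommRing A] (M : Type*) [AddCommGroup M] [Module A M]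
    (n : ℕ) : Prop :=
  ∀ (p : Ideal A) [p.IsPrime], p.height ≤ (n : ℕ∞) →
    Module.Free (Localization.AtPrime p) (LocalizedModule p.primeCompl M)

/-- A ring is catenary if any two saturated finite chains of primes with the same ends have the
same length. (For a Noetherian ring all chains between two given primes have bounded length.) -/
def IsCatenaryRing (A : Type*) [CommRing A] : Prop :=
  ∀ c d : RelSeries {(p, q) : PrimeSpectrum A × PrimeSpectrum A | p ⋖ q},
    c.head = d.head → c.last = d.last → c.length = d.length

/-- A ring is equidimensional if `dim A/p = dim A` for every minimal prime `p`. -/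
def IsEquidimensionalRing (A : Type*) [CommRing A] : Prop :=
  ∀ p ∈ minimalPrimes A, ringKrullDim (A ⧸ p) = ringKrullDim A

/-!
Every prime `P` of `S` not containing `f` lies just below a prime `Q ⊇ P + (f)`: one can choose
`Q` with `P ⋖ Q` (Krull's principal ideal theorem), or with `dim S/P ≤ dim S/Q + 1`. Let `q` be the
image of `Q` in `R = S/(f)`. Then `M_q = N_Q / f N_Q`, so freeness of `M_q` lifts to `N_Q` by
Nakayama's lemma and `depth N_Q ≥ depth M_q + 1`. From `Q` one descends to `P` by localizing, which
preserves freeness and, along a cover `P ⋖ Q`, lowers the depth by at most one by Rees' description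
of grade through the vanishing of `Ext`. In the catenary and equidimensional case every saturated
chain from a minimal prime to `Q` has length `ht Q`, so that `ht Q = ht P + 1` along a cover.

For the statement on `Ext`, let `0 → Z → F → N → 0` be exact with `F` free. It stays exact modulo
`f`, so `Ext¹_R(M, K/fK) = 0` lets every map `Z → K/fK` extend to `F`, that is
`Ext¹_S(N, K/fK) = 0`. Hence `f` acts surjectively on the finitely generated module `Ext¹_S(N, K)`,
which therefore vanishes, and the long exact sequence of `0 → K → K → K/fK → 0` yields the
surjectivity of the reduction of homomorphisms.
-/

section Grade

open RingTheory.Sequence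

variable {A : Type*} [CommRing A]

/-- The grade of an ideal `I` on a module `M`: the supremum of the lengths of the sequences of
elements of `I` that are weakly regular on `M`. As for `moduleDepth`, which is the case of the
maximal ideal of a local ring, the value is `⊤` when `M` is zero. -/
noncomputable def moduleGrade (I : Ideal A) (M : Type*) [AddCommGroup M] [Module A M] : ℕ∞ :=
  ⨆ (rs : List A) (_ : ∀ r ∈ rs, r ∈ I) (_ : IsWeaklyRegular M rs), (rs.length : ℕ∞)

theorem moduleDepth_eq_moduleGrade (A : Type*) [CommRing A] [IsLocalRing A] (M : Type*)
    [AddCommGroup M] [Module A M] :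
    moduleDepth A M = moduleGrade (IsLocalRing.maximalIdeal A) M :=
  rfl

variable {I : Ideal A} {M M' : Type*} [AddCommGroup M] [Module A M] [AddCommGroup M'] [Module A M']

theorem length_le_moduleGrade {rs : List A} (hrs : ∀ r ∈ rs, r ∈ I) (h : IsWeaklyRegular M rs) :
    (rs.length : ℕ∞) ≤ moduleGrade I M :=
  le_iSup_of_le rs (le_iSup_of_le hrs (le_iSup_of_le h le_rfl))

theorem moduleGrade_le_iff {d : ℕ∞} :
    moduleGrade I M ≤ d ↔
      ∀ rs : List A, (∀ r ∈ rs, r ∈ I) → IsWeaklyRegular M rs → (rs.length : ℕ∞) ≤ d := by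
  simp only [moduleGrade, iSup_le_iff]

theorem natCast_le_moduleGrade_iff {k : ℕ} :
    (k : ℕ∞) ≤ moduleGrade I M ↔
      ∃ rs : List A, rs.length = k ∧ (∀ r ∈ rs, r ∈ I) ∧ IsWeaklyRegular M rs := by
  refine ⟨fun h ↦ ?_, ?_⟩
  · obtain ⟨rs, hrs, hreg, hlen⟩ : ∃ rs : List A, (∀ r ∈ rs, r ∈ I) ∧ IsWeaklyRegular M rs ∧
        k ≤ rs.length := by
      by_contra! hlt
      rcases k with _ | k
      · exact absurd (hlt [] (by simp) (.nil A M)) (by simp)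
      · have : moduleGrade I M ≤ k := moduleGrade_le_iff.mpr fun rs hrs hreg ↦
          Nat.cast_le.mpr (Nat.lt_succ_iff.mp (hlt rs hrs hreg))
        exact absurd (Nat.cast_le.mp (h.trans this)) k.lt_succ_self.not_ge
    rw [← rs.take_append_drop k, isWeaklyRegular_append_iff] at hreg
    exact ⟨rs.take k, List.length_take_of_le hlen, fun r hr ↦ hrs r (List.mem_of_mem_take hr),
      hreg.1⟩
  · rintro ⟨rs, rfl, hrs, hreg⟩
    exact length_le_moduleGrade hrs hreg

theorem moduleGrade_congr (e : M ≃ₗ[A] M') : moduleGrade I M = moduleGrade I M' := by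
  simp only [moduleGrade, e.isWeaklyRegular_congr]

theorem moduleGrade_eq_top_of_subsingleton [Subsingleton M] : moduleGrade I M = ⊤ := by
  refine ENat.eq_top_iff_forall_ge.mpr fun k ↦ natCast_le_moduleGrade_iff.mpr
    ⟨List.replicate k 0, List.length_replicate, fun r hr ↦ ?_, ⟨fun i hi a b _ ↦
      Subsingleton.elim a b⟩⟩
  rw [List.eq_of_mem_replicate hr]
  exact I.zero_mem

theorem moduleGrade_quotSMulTop_add_one_le {x : A} (hxI : x ∈ I) (hx : IsSMulRegular M x) :
    moduleGrade I (QuotSMulTop x M) + 1 ≤ moduleGrade I M := by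
  refine ENat.forall_natCast_le_iff_le.mp fun k hk ↦ ?_
  rcases k with _ | k
  · exact zero_le
  rw [Nat.cast_add_one, ENat.add_le_add_iff_right ENat.one_ne_top,
    natCast_le_moduleGrade_iff] at hk
  obtain ⟨rs, rfl, hrs, hreg⟩ := hk
  exact length_le_moduleGrade (rs := x :: rs) (List.forall_mem_cons.mpr ⟨hxI, hrs⟩)
    (.cons hx hreg)

section Algebra

variable {B : Type*} [CommRing B] [Algebra A B]

theorem moduleGrade_le_of_flat_of_isBaseChange [Module.Flat A B] {W : Type*} [AddCommGroup W]
    [Module A W] [Module B W] [IsScalarTower A B W] {g : M →ₗ[A] W} (hg : IsBaseChange B g) :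
    moduleGrade I M ≤ moduleGrade (I.map (algebraMap A B)) W := by
  refine moduleGrade_le_iff.mpr fun rs hrs h ↦ ?_
  rw [← List.length_map (as := rs) (algebraMap A B)]
  exact length_le_moduleGrade (List.forall_mem_map.mpr fun r hr ↦ Ideal.mem_map_of_mem _ (hrs r hr))
    (h.of_flat_of_isBaseChange hg)

theorem moduleGrade_le_moduleGrade_under [Module B M] [IsScalarTower A B M]
    (hAB : Function.Surjective (algebraMap A B)) (J : Ideal B) :
    moduleGrade J M ≤ moduleGrade (J.under A) M := by
  refine moduleGrade_le_iff.mpr fun rs hrs h ↦ ?_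
  obtain ⟨rs, rfl⟩ := List.map_surjective_iff.mpr hAB rs
  rw [isWeaklyRegular_map_algebraMap_iff] at h
  rw [List.length_map]
  exact length_le_moduleGrade (fun r hr ↦ hrs _ (List.mem_map_of_mem hr)) h

theorem moduleDepth_le_moduleDepth_of_surjective [IsLocalRing A] [IsLocalRing B] [Module B M]
    [IsScalarTower A B M] (hAB : Function.Surjective (algebraMap A B)) :
    moduleDepth B M ≤ moduleDepth A M := by
  have := IsLocalHom.of_surjective (algebraMap A B) hAB
  have h := moduleGrade_le_moduleGrade_under (M := M) hAB (IsLocalRing.maximalIdeal B)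
  rwa [Ideal.under, IsLocalRing.maximalIdeal_comap] at h

end Algebra

end Grade

section GradeOfCover

open RingTheory.Sequence CategoryTheory CategoryTheory.Abelian

universe v

theorem subsingleton_of_forall_exists_smul_eq {A M : Type*} [CommRing A] [AddCommGroup M]
    [Module A M] [Module.Finite A M] {x : A} (hx : x ∈ (⊥ : Ideal A).jacobson)
    (h : ∀ y : M, ∃ z : M, x • z = y) : Subsingleton M := by
  have hle : (⊤ : Submodule A M) ≤ Ideal.span {x} • ⊤ := fun y _ ↦ by
    obtain ⟨z, rfl⟩ := h y
    exact Submodule.smul_mem_smul (Ideal.mem_span_singleton_self x) trivial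
  have hbot := Submodule.eq_bot_of_le_smul_of_le_jacobson_bot _ _ Module.Finite.fg_top hle
    ((Ideal.span_singleton_le_iff_mem _).mpr hx)
  exact (Submodule.subsingleton_iff A).mp (subsingleton_of_bot_eq_top hbot.symm)

section Ext

variable {A : Type u} [CommRing A] [IsNoetherianRing A] [Small.{v} A]
  {L W : ModuleCat.{v} A} [Module.Finite A L] [Module.Finite A W]
  {x : A} (hxA : x ∈ (⊥ : Ideal A).jacobson)

include hxA

theorem subsingleton_ext_of_quotSMulTop_left (hx : IsSMulRegular L x) (i : ℕ)
    (h : Subsingleton (Ext (ModuleCat.of A (QuotSMulTop x L)) W (i + 1))) :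
    Subsingleton (Ext L W i) := by
  refine subsingleton_of_forall_exists_smul_eq hxA fun y ↦ ?_
  obtain ⟨z, hz⟩ : ∃ z : Ext L W i, (Ext.mk₀ (x • 𝟙 L)).comp z (zero_add i) = y :=
    Ext.contravariant_sequence_exact₁ hx.smulShortComplex_shortExact W y (add_comm 1 i) (h.elim _ _)
  exact ⟨z, by rw [← hz, Ext.mk₀_smul, Ext.smul_comp, Ext.mk₀_id_comp]⟩

theorem subsingleton_ext_of_quotSMulTop_right (hx : IsSMulRegular W x) (i : ℕ)
    (h : Subsingleton (Ext L (ModuleCat.of A (QuotSMulTop x W)) i)) :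
    Subsingleton (Ext L W i) := by
  refine subsingleton_of_forall_exists_smul_eq hxA fun y ↦ ?_
  obtain ⟨z, hz⟩ : ∃ z : Ext L W i, z.comp (Ext.mk₀ (x • 𝟙 W)) (add_zero i) = y :=
    Ext.covariant_sequence_exact₂ L hx.smulShortComplex_shortExact y (h.elim _ _)
  exact ⟨z, by rw [← hz, Ext.mk₀_smul, Ext.comp_smul, Ext.comp_mk₀_id]⟩

end Ext

section Rees

theorem smul_top_lt_top_of_le_maximalIdeal {A M : Type*} [CommRing A] [IsLocalRing A]
    [AddCommGroup M] [Module A M] [Module.Finite A M] [Nontrivial M] {I : Ideal A}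
    (hI : I ≤ IsLocalRing.maximalIdeal A) : I • (⊤ : Submodule A M) < ⊤ :=
  (Submodule.top_ne_ideal_smul_of_le_jacobson_annihilator
    (hI.trans (IsLocalRing.maximalIdeal_le_jacobson _))).symm.lt_top

variable {A : Type u} [CommRing A] [IsLocalRing A] [IsNoetherianRing A] [Small.{v} A]
  {I : Ideal A} {L W : ModuleCat.{v} A} [Module.Finite A L] [Module.Finite A W] [Nontrivial W]

theorem subsingleton_ext_of_lt_moduleGrade (hI : I ≤ IsLocalRing.maximalIdeal A)
    (hL : Module.support A L ⊆ PrimeSpectrum.zeroLocus I) {i : ℕ} (hi : i < moduleGrade I W) :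
    Subsingleton (Ext L W i) := by
  obtain ⟨rs, hlen, hrs, hreg⟩ := natCast_le_moduleGrade_iff.mp
    (show ((i + 1 : ℕ) : ℕ∞) ≤ moduleGrade I W from Order.add_one_le_of_lt hi)
  exact ModuleCat.subsingleton_ext_of_exists_isRegular I L hL W
    (smul_top_lt_top_of_le_maximalIdeal hI) rs hrs
    ((IsLocalRing.isRegular_iff_isWeaklyRegular_of_subset_maximalIdeal
      fun r hr ↦ hI (hrs r hr)).mpr hreg) i (by omega)

theorem natCast_le_moduleGrade_of_subsingleton_ext (hI : I ≤ IsLocalRing.maximalIdeal A)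
    (hL : Module.support A L = PrimeSpectrum.zeroLocus I) {k : ℕ}
    (h : ∀ i < k, Subsingleton (Ext L W i)) : k ≤ moduleGrade I W := by
  obtain ⟨rs, hlen, hrs, hreg⟩ := ModuleCat.exists_isRegular_of_exists_subsingleton_ext I k W
    (smul_top_lt_top_of_le_maximalIdeal hI) L hL h
  exact natCast_le_moduleGrade_iff.mpr ⟨rs, hlen, hrs, hreg.toIsWeaklyRegular⟩

end Rees

section Cover

variable {A : Type u} [CommRing A]

theorem isSMulRegular_quotient_of_notMem {p : Ideal A} [p.IsPrime] {x : A} (hx : x ∉ p) :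
    IsSMulRegular (A ⧸ p) x := by
  have hx0 : algebraMap A (A ⧸ p) x ≠ 0 := mt Ideal.Quotient.eq_zero_iff_mem.mp hx
  exact (isSMulRegular_algebraMap_iff (A ⧸ p)).mp (.of_ne_zero hx0)

variable [IsLocalRing A]

theorem support_quotSMulTop_quotient_subset_of_covBy {p : PrimeSpectrum A}
    (hp : p ⋖ IsLocalRing.closedPoint A) {x : A} (hx : x ∉ p.asIdeal) :
    Module.support A (QuotSMulTop x (A ⧸ p.asIdeal)) ⊆
      PrimeSpectrum.zeroLocus (IsLocalRing.maximalIdeal A) := by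
  rw [Module.support_quotSMulTop, Module.support_eq_zeroLocus, Ideal.annihilator_quotient]
  rintro r ⟨hpr, hxr⟩
  have hpr' : p < r := lt_of_le_of_ne hpr (by rintro rfl; exact hx (hxr rfl))
  exact (hp.eq_or_eq hpr'.le (IsLocalRing.le_maximalIdeal_of_isPrime r.asIdeal)).elim
    (fun h ↦ absurd h hpr'.ne') fun h ↦ h ▸ fun _ ↦ id

-- For `x ∉ p` the module `A ⧸ (p + (x))` is supported at the closed point only, and `Ext`
-- vanishing for it gives, one degree lower, `Ext` vanishing for `A ⧸ p`.
theorem moduleDepth_le_moduleGrade_add_one_of_covBy [IsNoetherianRing A] (W : Type u)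
    [AddCommGroup W] [Module A W] [Module.Finite A W] {p : PrimeSpectrum A}
    (hp : p ⋖ IsLocalRing.closedPoint A) :
    moduleDepth A W ≤ moduleGrade p.asIdeal W + 1 := by
  rcases subsingleton_or_nontrivial W with _ | _
  · rw [moduleGrade_eq_top_of_subsingleton]
    exact le_top
  obtain ⟨x, hxm, hxp⟩ := SetLike.exists_of_lt
    (show p.asIdeal < IsLocalRing.maximalIdeal A from hp.lt)
  refine ENat.forall_natCast_le_iff_le.mp fun k hk ↦ ?_
  rcases k with _ | k
  · exact zero_le
  rw [Nat.cast_add_one, ENat.add_le_add_iff_right ENat.one_ne_top]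
  refine natCast_le_moduleGrade_of_subsingleton_ext (L := ModuleCat.of A (A ⧸ p.asIdeal))
    (W := ModuleCat.of A W) (IsLocalRing.le_maximalIdeal_of_isPrime p.asIdeal)
    (by rw [Module.support_eq_zeroLocus, Ideal.annihilator_quotient]) fun i hi ↦ ?_
  exact subsingleton_ext_of_quotSMulTop_left (IsLocalRing.maximalIdeal_le_jacobson _ hxm)
    (isSMulRegular_quotient_of_notMem hxp) i (subsingleton_ext_of_lt_moduleGrade le_rfl
      (support_quotSMulTop_quotient_subset_of_covBy hp hxp)
      (lt_of_lt_of_le (by exact_mod_cast Nat.succ_lt_succ hi) hk))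

end Cover

end GradeOfCover

section Localization

section BaseChange

variable {S A B V W N : Type*} [CommRing S] [CommRing A] [CommRing B] [Algebra S A] [Algebra S B]
  [Algebra A B] [IsScalarTower S A B] [AddCommGroup N] [Module S N] [AddCommGroup V] [Module S V]
  [Module A V] [IsScalarTower S A V] [AddCommGroup W] [Module S W] [Module B W]
  [IsScalarTower S B W]

/-- If `V` and `W` are base changes of the `S`-module `N` to the algebras `A` and `B` of a tower
`S → A → B`, then `W` is the base change of `V` to `B`. -/
noncomputable def tensorEquivOfIsBaseChange {g : N →ₗ[S] V} {h : N →ₗ[S] W}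
    (hg : IsBaseChange A g) (hh : IsBaseChange B h) : TensorProduct A B V ≃ₗ[B] W :=
  (hg.comp (TensorProduct.isBaseChange A V B)).equiv.symm ≪≫ₗ hh.equiv

theorem moduleGrade_map_le_of_flat_of_isBaseChange [Module.Flat A B] {g : N →ₗ[S] V}
    {h : N →ₗ[S] W} (hg : IsBaseChange A g) (hh : IsBaseChange B h) (I : Ideal S) :
    moduleGrade (I.map (algebraMap S A)) V ≤ moduleGrade (I.map (algebraMap S B)) W := by
  rw [← moduleGrade_congr (tensorEquivOfIsBaseChange hg hh),
    IsScalarTower.algebraMap_eq S A B, ← Ideal.map_map]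
  exact moduleGrade_le_of_flat_of_isBaseChange (TensorProduct.isBaseChange A V B)

end BaseChange

variable {S : Type*} [CommRing S] (N : Type*) [AddCommGroup N] [Module S N]

theorem isBaseChange_localizedModule_mkLinearMap (P : Ideal S) [P.IsPrime] :
    IsBaseChange (Localization.AtPrime P) (LocalizedModule.mkLinearMap P.primeCompl N) :=
  IsLocalizedModule.isBaseChange P.primeCompl _ _

variable {P Q : Ideal S} [P.IsPrime] [Q.IsPrime]

theorem free_localizedModule_of_le (hPQ : P ≤ Q)
    [Module.Free (Localization.AtPrime Q) (LocalizedModule Q.primeCompl N)] :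
    Module.Free (Localization.AtPrime P) (LocalizedModule P.primeCompl N) := by
  have hle : Q.primeCompl ≤ P.primeCompl := fun _ hx hxP ↦ hx (hPQ hxP)
  let : Algebra (Localization.AtPrime Q) (Localization.AtPrime P) :=
    IsLocalization.localizationAlgebraOfSubmonoidLe _ _ _ _ hle
  have : IsScalarTower S (Localization.AtPrime Q) (Localization.AtPrime P) :=
    IsLocalization.localization_isScalarTower_of_submonoid_le _ _ _ _ hle
  exact .of_equiv (tensorEquivOfIsBaseChange (isBaseChange_localizedModule_mkLinearMap N Q)
    (isBaseChange_localizedModule_mkLinearMap N P))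

theorem moduleGrade_map_localizedModule_le_moduleDepth (hPQ : P ≤ Q) :
    moduleGrade (P.map (algebraMap S (Localization.AtPrime Q)))
        (LocalizedModule Q.primeCompl N) ≤
      moduleDepth (Localization.AtPrime P) (LocalizedModule P.primeCompl N) := by
  have hle : Q.primeCompl ≤ P.primeCompl := fun _ hx hxP ↦ hx (hPQ hxP)
  let : Algebra (Localization.AtPrime Q) (Localization.AtPrime P) :=
    IsLocalization.localizationAlgebraOfSubmonoidLe _ _ _ _ hle
  have : IsScalarTower S (Localization.AtPrime Q) (Localization.AtPrime P) :=
    IsLocalization.localization_isScalarTower_of_submonoid_le _ _ _ _ hle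
  have : IsLocalization (P.primeCompl.map (algebraMap S (Localization.AtPrime Q)))
      (Localization.AtPrime P) :=
    IsLocalization.isLocalization_of_submonoid_le _ _ _ _ hle
  have : Module.Flat (Localization.AtPrime Q) (Localization.AtPrime P) :=
    IsLocalization.flat _ (P.primeCompl.map (algebraMap S (Localization.AtPrime Q)))
  rw [moduleDepth_eq_moduleGrade, ← Localization.AtPrime.map_eq_maximalIdeal]
  exact moduleGrade_map_le_of_flat_of_isBaseChange (isBaseChange_localizedModule_mkLinearMap N Q)
    (isBaseChange_localizedModule_mkLinearMap N P) P

theorem moduleDepth_localizedModule_le_add_one_of_covBy {S : Type u} [CommRing S]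
    [IsNoetherianRing S] (N : Type u) [AddCommGroup N] [Module S N] [Module.Finite S N]
    {p q : PrimeSpectrum S} (hpq : p ⋖ q) :
    moduleDepth (Localization.AtPrime q.asIdeal) (LocalizedModule q.asIdeal.primeCompl N) ≤
      moduleDepth (Localization.AtPrime p.asIdeal)
        (LocalizedModule p.asIdeal.primeCompl N) + 1 := by
  let A := Localization.AtPrime q.asIdeal
  let e := IsLocalization.AtPrime.primeSpectrumOrderIso A q.asIdeal
  let p' : PrimeSpectrum A := e.symm ⟨p, hpq.le⟩
  have hclosed : e (IsLocalRing.closedPoint A) = ⟨q, le_refl q⟩ :=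
    Subtype.ext (PrimeSpectrum.ext (IsLocalization.AtPrime.under_maximalIdeal A q.asIdeal))
  have hp' : p' ⋖ IsLocalRing.closedPoint A := by
    rw [← apply_covBy_apply_iff e, e.apply_symm_apply, hclosed,
      ← Set.OrdConnected.apply_covBy_apply_iff (OrderEmbedding.subtype _)
        (by simpa using! Set.ordConnected_Iic (a := q))]
    exact hpq
  have hpp' : p'.asIdeal = p.asIdeal.map (algebraMap S A) := rfl
  calc _ ≤ moduleGrade p'.asIdeal (LocalizedModule q.asIdeal.primeCompl N) + 1 :=
        moduleDepth_le_moduleGrade_add_one_of_covBy _ hp'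
    _ ≤ _ := by
        rw [hpp']
        gcongr
        exact moduleGrade_map_localizedModule_le_moduleDepth N hpq.le

end Localization

section Reduction

theorem mem_nonZeroDivisors_of_isSMulRegular {A : Type*} [CommRing A] {x : A}
    (hx : IsSMulRegular A x) : x ∈ nonZeroDivisors A :=
  mem_nonZeroDivisors_iff_right.mpr fun y hy ↦
    hx.right_eq_zero_of_smul (by rwa [smul_eq_mul, mul_comm])

section Local

variable {A B : Type*} [CommRing A] [CommRing B] [Algebra A B] {x : A}

/-- If `B = A / (x)`, then the base change of `V` to `B` is `V / x V`. -/
noncomputable def tensorEquivQuotSMulTop (hAB : Function.Surjective (algebraMap A B))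
    (hker : RingHom.ker (algebraMap A B) = Ideal.span {x}) (V : Type*) [AddCommGroup V]
    [Module A V] : TensorProduct A B V ≃ₗ[A] QuotSMulTop x V :=
  let e : (A ⧸ Ideal.span {x}) ≃ₐ[A] B := (Ideal.quotientEquivAlgOfEq A hker.symm).trans
    (Ideal.quotientKerAlgEquivOfSurjective (f := Algebra.ofId A B) hAB)
  (TensorProduct.congr e.symm.toLinearEquiv (LinearEquiv.refl A V)).trans
    (QuotSMulTop.equivQuotTensor x V).symm

variable {V : Type*} [AddCommGroup V] [Module A V]

attribute [local instance] RingHomInvPair.of_ringEquiv in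
theorem free_of_free_tensorProduct [IsLocalRing A] [Module.FinitePresentation A V]
    (hAB : Function.Surjective (algebraMap A B))
    (hker : RingHom.ker (algebraMap A B) = Ideal.span {x})
    (hxm : x ∈ IsLocalRing.maximalIdeal A) (hx : IsSMulRegular V x)
    [Module.Free B (TensorProduct A B V)] : Module.Free A V := by
  let σ : (A ⧸ Ideal.span {x}) ≃+* B := (Ideal.quotEquivOfEq hker.symm).trans
    (RingHom.quotientKerEquivOfSurjective hAB)
  refine (Module.free_quotSMulTop_iff_free A V
    (IsLocalRing.maximalIdeal_le_jacobson _ hxm) hx).mp ?_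
  let e : QuotSMulTop x V ≃ₛₗ[(σ : (A ⧸ Ideal.span {x}) →+* B)] TensorProduct A B V :=
    { __ := (tensorEquivQuotSMulTop hAB hker V).symm
      map_smul' := fun r v ↦ by
        obtain ⟨a, rfl⟩ := Ideal.Quotient.mk_surjective r
        have := (tensorEquivQuotSMulTop hAB hker V).symm.map_smul a v
        exact this.trans (algebraMap_smul B a _).symm }
  exact (Module.Free.iff_of_equiv e).mpr ‹_›

theorem moduleDepth_tensorProduct_add_one_le [IsLocalRing A] [IsLocalRing B]
    (hAB : Function.Surjective (algebraMap A B))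
    (hker : RingHom.ker (algebraMap A B) = Ideal.span {x})
    (hxm : x ∈ IsLocalRing.maximalIdeal A) (hx : IsSMulRegular V x) :
    moduleDepth B (TensorProduct A B V) + 1 ≤ moduleDepth A V := by
  refine le_trans ?_ (moduleGrade_quotSMulTop_add_one_le hxm hx)
  rw [← moduleGrade_congr (tensorEquivQuotSMulTop hAB hker V)]
  exact add_le_add_left (moduleDepth_le_moduleDepth_of_surjective hAB) 1

end Local

theorem isBaseChange_mkQ_smul_top {S : Type*} [CommRing S] (N : Type*) [AddCommGroup N]
    [Module S N] (f : S) :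
    IsBaseChange (S ⧸ Ideal.span {f}) (f • (⊤ : Submodule S N)).mkQ := by
  refine IsBaseChange.of_equiv
    ((QuotSMulTop.equivQuotTensor f N).extendScalarsOfSurjective
      Ideal.Quotient.mk_surjective).symm fun x ↦ ?_
  rw [LinearEquiv.symm_apply_eq]
  rfl

section Primes

variable {S R : Type*} [CommRing S] [CommRing R] [Algebra S R]
  (hSR : Function.Surjective (algebraMap S R)) (Q : Ideal S) (q : Ideal R) [q.LiesOver Q]

include hSR

theorem ringKrullDim_quotient_eq_of_surjective : ringKrullDim (S ⧸ Q) = ringKrullDim (R ⧸ q) := by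
  have hker : RingHom.ker ((Ideal.Quotient.mk q).comp (algebraMap S R)) = Q := by
    rw [← RingHom.comap_ker, Ideal.mk_ker, Ideal.LiesOver.over (p := Q) (P := q)]
  rw [← hker]
  exact ringKrullDim_eq_of_ringEquiv
    (RingHom.quotientKerEquivOfSurjective (Ideal.Quotient.mk_surjective.comp hSR))

variable [Q.IsPrime] [q.IsPrime]

theorem map_primeCompl_algebraMap : Q.primeCompl.map (algebraMap S R) = q.primeCompl := by
  ext x
  obtain ⟨x, rfl⟩ := hSR x
  refine ⟨?_, fun hx ↦ ⟨x, mt (Ideal.mem_of_liesOver q Q x).mp hx, rfl⟩⟩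
  rintro ⟨y, hy, hyx⟩
  rw [← hyx]
  exact mt (Ideal.mem_of_liesOver q Q y).mpr hy

variable [Algebra (Localization.AtPrime Q) (Localization.AtPrime q)]
  [Localization.AtPrime.IsLiesOverAlgebra Q q]

theorem algebraMap_localization_surjective :
    Function.Surjective (algebraMap (Localization.AtPrime Q) (Localization.AtPrime q)) := by
  rw [Localization.AtPrime.IsLiesOverAlgebra.algebraMap_eq]
  exact (RingHom.surjectiveOnStalks_of_surjective hSR).localRingHom_surjective _ _ _

theorem ker_algebraMap_localization :
    RingHom.ker (algebraMap (Localization.AtPrime Q) (Localization.AtPrime q)) =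
      (RingHom.ker (algebraMap S R)).map (algebraMap S (Localization.AtPrime Q)) := by
  rw [Localization.AtPrime.IsLiesOverAlgebra.algebraMap_eq]
  exact IsLocalization.ker_map _ _ (map_primeCompl_algebraMap hSR Q q)

end Primes

theorem exists_isPrime_liesOver_quotient_span_singleton {S : Type*} [CommRing S] {f : S}
    (Q : Ideal S) [Q.IsPrime] (hf : f ∈ Q) :
    ∃ q : Ideal (S ⧸ Ideal.span {f}), q.IsPrime ∧ q.LiesOver Q := by
  have hle : RingHom.ker (Ideal.Quotient.mk (Ideal.span {f})) ≤ Q := by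
    rwa [Ideal.mk_ker, Ideal.span_singleton_le_iff_mem]
  refine ⟨Q.map (Ideal.Quotient.mk (Ideal.span {f})),
    Ideal.map_isPrime_of_surjective Ideal.Quotient.mk_surjective hle, ⟨?_⟩⟩
  rw [Ideal.under_def, Ideal.Quotient.algebraMap_eq,
    Ideal.comap_map_of_surjective' _ Ideal.Quotient.mk_surjective, sup_eq_left.mpr hle]

section Quotient

variable {S : Type*} [CommRing S] {f : S} (N : Type*) [AddCommGroup N] [Module S N]
  (Q : Ideal S) (q : Ideal (S ⧸ Ideal.span {f})) [q.LiesOver Q]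

include q

theorem mem_of_liesOver_quotient_span_singleton : f ∈ Q := by
  rw [Ideal.mem_of_liesOver q Q, Ideal.Quotient.algebraMap_eq,
    Ideal.Quotient.eq_zero_iff_mem.mpr (Ideal.mem_span_singleton_self f)]
  exact q.zero_mem

theorem height_le_height_add_one_of_liesOver [IsNoetherianRing S] [Q.IsPrime] :
    Q.height ≤ q.height + 1 := by
  have := Ideal.height_le_height_add_one_of_mem (mem_of_liesOver_quotient_span_singleton Q q)
  rwa [Ideal.LiesOver.over (p := Q) (P := q), Ideal.under_def, Ideal.Quotient.algebraMap_eq,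
    Ideal.map_comap_of_surjective _ Ideal.Quotient.mk_surjective,
    ← Ideal.Quotient.algebraMap_eq, ← Ideal.under_def, ← Ideal.LiesOver.over (p := Q)] at this

variable [Q.IsPrime]

theorem algebraMap_localization_mem_maximalIdeal :
    algebraMap S (Localization.AtPrime Q) f ∈
      IsLocalRing.maximalIdeal (Localization.AtPrime Q) :=
  (IsLocalization.AtPrime.to_map_mem_maximal_iff _ Q f).mpr
    (mem_of_liesOver_quotient_span_singleton Q q)

variable [q.IsPrime] [Algebra (Localization.AtPrime Q) (Localization.AtPrime q)]
  [Localization.AtPrime.IsLiesOverAlgebra Q q]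

theorem ker_algebraMap_localization_quotient :
    RingHom.ker (algebraMap (Localization.AtPrime Q) (Localization.AtPrime q)) =
      Ideal.span {algebraMap S (Localization.AtPrime Q) f} := by
  rw [ker_algebraMap_localization Ideal.Quotient.mk_surjective, Ideal.Quotient.algebraMap_eq,
    Ideal.mk_ker, Ideal.map_span, Set.image_singleton]

/-- If `q` is the image of `Q` in `S / (f)`, then the localization of `N / f N` at `q` is the base
change of the localization of `N` at `Q`. -/
noncomputable def tensorEquivLocalizedModuleQuotSMulTop :
    TensorProduct (Localization.AtPrime Q) (Localization.AtPrime q)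
        (LocalizedModule Q.primeCompl N) ≃ₗ[Localization.AtPrime q]
      LocalizedModule q.primeCompl (QuotSMulTop f N) :=
  tensorEquivOfIsBaseChange (isBaseChange_localizedModule_mkLinearMap N Q)
    ((isBaseChange_mkQ_smul_top N f).comp
      (isBaseChange_localizedModule_mkLinearMap (QuotSMulTop f N) q))

end Quotient

section LiesOver

variable {S : Type*} [CommRing S] {f : S} (N : Type*) [AddCommGroup N] [Module S N]
  (Q : Ideal S) [Q.IsPrime] (q : Ideal (S ⧸ Ideal.span {f})) [q.IsPrime] [q.LiesOver Q]

theorem isSMulRegular_localizedModule (hf : IsSMulRegular N f) :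
    IsSMulRegular (LocalizedModule Q.primeCompl N) (algebraMap S (Localization.AtPrime Q) f) :=
  hf.of_isLocalizedModule (Localization.AtPrime Q) Q.primeCompl
    (LocalizedModule.mkLinearMap Q.primeCompl N)

theorem free_localizedModule_of_liesOver [IsNoetherianRing S] [Module.Finite S N]
    (hf : IsSMulRegular N f)
    [Module.Free (Localization.AtPrime q) (LocalizedModule q.primeCompl (QuotSMulTop f N))] :
    Module.Free (Localization.AtPrime Q) (LocalizedModule Q.primeCompl N) := by
  let := Localization.AtPrime.algebraOfLiesOver Q q
  have := Module.Free.of_equiv (tensorEquivLocalizedModuleQuotSMulTop N Q q).symm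
  have := Module.finitePresentation_of_finite (Localization.AtPrime Q)
    (LocalizedModule Q.primeCompl N)
  exact free_of_free_tensorProduct
    (algebraMap_localization_surjective Ideal.Quotient.mk_surjective Q q)
    (ker_algebraMap_localization_quotient Q q) (algebraMap_localization_mem_maximalIdeal Q q)
    (isSMulRegular_localizedModule N Q hf)

theorem moduleDepth_localizedModule_add_one_le_of_liesOver (hf : IsSMulRegular N f) :
    moduleDepth (Localization.AtPrime q) (LocalizedModule q.primeCompl (QuotSMulTop f N)) + 1 ≤
      moduleDepth (Localization.AtPrime Q) (LocalizedModule Q.primeCompl N) := by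
  let := Localization.AtPrime.algebraOfLiesOver Q q
  rw [moduleDepth_eq_moduleGrade (Localization.AtPrime q),
    ← moduleGrade_congr (M := TensorProduct (Localization.AtPrime Q) (Localization.AtPrime q)
      (LocalizedModule Q.primeCompl N)) (tensorEquivLocalizedModuleQuotSMulTop N Q q),
    ← moduleDepth_eq_moduleGrade]
  exact moduleDepth_tensorProduct_add_one_le
    (algebraMap_localization_surjective Ideal.Quotient.mk_surjective Q q)
    (ker_algebraMap_localization_quotient Q q) (algebraMap_localization_mem_maximalIdeal Q q)
    (isSMulRegular_localizedModule N Q hf)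

theorem height_add_one_le_of_liesOver (hf : IsSMulRegular S f) : q.height + 1 ≤ Q.height := by
  let := Localization.AtPrime.algebraOfLiesOver Q q
  have hf' : algebraMap S (Localization.AtPrime Q) f ∈ nonZeroDivisors (Localization.AtPrime Q) :=
    mem_nonZeroDivisors_of_isSMulRegular
      (hf.of_isLocalization (Localization.AtPrime Q) Q.primeCompl)
  have hdim := ringKrullDim_succ_le_of_surjective _
    (algebraMap_localization_surjective Ideal.Quotient.mk_surjective Q q) hf'
    (RingHom.mem_ker.mp (ker_algebraMap_localization_quotient Q q ▸
      Ideal.mem_span_singleton_self _))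
  rw [IsLocalization.AtPrime.ringKrullDim_eq_height Q (Localization.AtPrime Q),
    IsLocalization.AtPrime.ringKrullDim_eq_height q (Localization.AtPrime q)] at hdim
  exact_mod_cast hdim

end LiesOver

end Reduction

section Dimension

theorem coheight_eq_ringKrullDim_quotient {S : Type*} [CommRing S] (p : PrimeSpectrum S) :
    (Order.coheight p : WithBot ℕ∞) = ringKrullDim (S ⧸ p.asIdeal) := by
  rw [Order.coheight_eq_krullDim_Ici, ringKrullDim_quotient]
  rfl

theorem exists_isPrime_ringKrullDim_quotient_eq (A : Type*) [CommRing A] [FiniteRingKrullDim A] :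
    ∃ p : Ideal A, p.IsPrime ∧ ringKrullDim (A ⧸ p) = ringKrullDim A := by
  let c := LTSeries.longestOf (PrimeSpectrum A)
  refine ⟨c.head.asIdeal, c.head.isPrime, (ringKrullDim_quotient_le _).antisymm ?_⟩
  rw [← coheight_eq_ringKrullDim_quotient, ringKrullDim,
    Order.krullDim_eq_length_of_finiteDimensionalOrder]
  exact WithBot.coe_le_coe.mpr (Order.length_le_coheight le_rfl)

variable {S : Type*} [CommRing S] [IsNoetherianRing S] {f : S} {I : Ideal S}

theorem ringKrullDim_quotient_le_ringKrullDim_quotient_sup_span_singleton_add_one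
    (hf : f ∈ I.jacobson) :
    ringKrullDim (S ⧸ I) ≤ ringKrullDim (S ⧸ I ⊔ Ideal.span {f}) + 1 := by
  have hf' : Ideal.Quotient.mk I f ∈ Ring.jacobson (S ⧸ I) := by
    rwa [← Ideal.jacobson_bot, ← Ideal.mem_comap,
      Ideal.comap_jacobson_of_surjective Ideal.Quotient.mk_surjective, ← RingHom.ker_eq_comap_bot,
      Ideal.mk_ker]
  have hdim := ringKrullDim_le_ringKrullDim_quotient_add_encard {Ideal.Quotient.mk I f}
    (Set.singleton_subset_iff.mpr hf')
  rw [← Set.image_singleton, ← Ideal.map_span,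
    ringKrullDim_eq_of_ringEquiv (DoubleQuot.quotQuotEquivQuotSup I (Ideal.span {f})),
    Set.image_singleton, Set.encard_singleton] at hdim
  exact hdim

theorem exists_isPrime_ringKrullDim_quotient_le_add_one [IsLocalRing S]
    (hf : f ∈ IsLocalRing.maximalIdeal S) (hI : I ≠ ⊤) :
    ∃ Q : Ideal S, Q.IsPrime ∧ I ≤ Q ∧ f ∈ Q ∧
      ringKrullDim (S ⧸ I) ≤ ringKrullDim (S ⧸ Q) + 1 := by
  let J := I ⊔ Ideal.span {f}
  have hJ : J ≤ IsLocalRing.maximalIdeal S :=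
    sup_le (IsLocalRing.le_maximalIdeal hI) ((Ideal.span_singleton_le_iff_mem _).mpr hf)
  have : Nontrivial (S ⧸ J) :=
    Ideal.Quotient.nontrivial_iff.mpr (ne_top_of_le_ne_top Ideal.IsPrime.ne_top' hJ)
  have : IsLocalRing (S ⧸ J) := .of_surjective' _ Ideal.Quotient.mk_surjective
  obtain ⟨q, hq, hdim⟩ := exists_isPrime_ringKrullDim_quotient_eq (S ⧸ J)
  have hJq : J ≤ q.under S := Ideal.mk_ker.ge.trans (Ideal.ker_le_comap (Ideal.Quotient.mk J))
  have hQ := ringKrullDim_quotient_eq_of_surjective (S := S) (R := S ⧸ J)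
    Ideal.Quotient.mk_surjective (q.under S) q
  refine ⟨q.under S, inferInstance, le_sup_left.trans hJq,
    hJq (Ideal.mem_sup_right (Ideal.mem_span_singleton_self f)), ?_⟩
  rw [hQ.trans hdim]
  refine ringKrullDim_quotient_le_ringKrullDim_quotient_sup_span_singleton_add_one ?_
  rwa [IsLocalRing.jacobson_eq_maximalIdeal I hI]

end Dimension

section SaturatedChain

/-- The saturated finite chains of a partially ordered set: each term is covered by the next. -/
abbrev SaturatedChain (α : Type*) [PartialOrder α] : Type _ :=
  RelSeries {(a, b) : α × α | a ⋖ b}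

section Order

variable {α : Type*} [PartialOrder α]

theorem SaturatedChain.length_le_height (c : SaturatedChain α) :
    (c.length : ℕ∞) ≤ Order.height c.last :=
  Order.length_le_height (p := c.ofLE fun _ h ↦ h.lt) le_rfl

variable [FiniteDimensionalOrder α]

theorem exists_saturatedChain_of_ltSeries (s : LTSeries α) :
    ∃ c : SaturatedChain α, c.head = s.head ∧ c.last = s.last ∧ s.length ≤ c.length := by
  have : WellFoundedLT α := ⟨SetRel.IsWellFounded.of_finiteDimensional {(a, b) : α × α | a < b}⟩
  have : WellFoundedGT α :=
    ⟨SetRel.IsWellFounded.inv_of_finiteDimensional {(a, b) : α × α | a < b}⟩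
  obtain ⟨c, i, hi, h0, hl⟩ := s.exists_relSeries_covBy
  refine ⟨c, ?_, ?_, by simpa using Fintype.card_le_of_embedding i⟩
  · rw [RelSeries.head, RelSeries.head, ← hi, Function.comp_apply, h0]
  · rw [RelSeries.last, RelSeries.last, ← hi, Function.comp_apply, hl]

theorem exists_saturatedChain_of_le {a b : α} (h : a ≤ b) :
    ∃ c : SaturatedChain α, c.head = a ∧ c.last = b := by
  rcases h.eq_or_lt with rfl | h
  · exact ⟨RelSeries.singleton _ a, rfl, rfl⟩
  · obtain ⟨c, h0, hl, -⟩ := exists_saturatedChain_of_ltSeries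
      (RelSeries.snoc (RelSeries.singleton _ a) b h)
    exact ⟨c, h0.trans (RelSeries.head_snoc ..), hl.trans (RelSeries.last_snoc ..)⟩

end Order

section PrimeSpectrum

variable {S : Type*} [CommRing S] [FiniteRingKrullDim S]

theorem exists_saturatedChain_minimalPrimes (q : PrimeSpectrum S) :
    ∃ c : SaturatedChain (PrimeSpectrum S), c.head.asIdeal ∈ minimalPrimes S ∧ c.last = q := by
  obtain ⟨P, hP, hPq⟩ := Ideal.exists_minimalPrimes_le (J := q.asIdeal) bot_le
  obtain ⟨c, h0, hl⟩ := exists_saturatedChain_of_le (a := ⟨P, hP.1.1⟩) (b := q) hPq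
  exact ⟨c, h0 ▸ hP, hl⟩

variable [IsLocalRing S]

theorem exists_saturatedChain_closedPoint (p : PrimeSpectrum S) :
    ∃ c : SaturatedChain (PrimeSpectrum S), c.head = p ∧ c.last = IsLocalRing.closedPoint S :=
  exists_saturatedChain_of_le (IsLocalRing.le_maximalIdeal_of_isPrime p.asIdeal)

variable (hc : IsCatenaryRing S) (he : IsEquidimensionalRing S)

include hc he

theorem length_eq_ringKrullDim_of_isCatenaryRing {c : SaturatedChain (PrimeSpectrum S)}
    (h0 : c.head.asIdeal ∈ minimalPrimes S) (hl : c.last = IsLocalRing.closedPoint S) :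
    (c.length : WithBot ℕ∞) = ringKrullDim S := by
  have hle : c.length ≤ ringKrullDim S :=
    Order.LTSeries.length_le_krullDim (c.ofLE fun _ h ↦ h.lt)
  refine hle.antisymm ?_
  rw [← he _ h0, ← coheight_eq_ringKrullDim_quotient]
  refine WithBot.coe_le_coe.mpr (Order.coheight_le fun s hs ↦ ?_)
  obtain ⟨a, ha0, hal, hsa⟩ := exists_saturatedChain_of_ltSeries s
  obtain ⟨b, hb0, hbl⟩ := exists_saturatedChain_closedPoint s.last
  have hlen := hc c (a.smash b (hal.trans hb0.symm)) (by simp [ha0, hs]) (by simp [hl, hbl])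
  rw [hlen, RelSeries.smash_length]
  exact_mod_cast hsa.trans (Nat.le_add_right _ _)

theorem length_eq_height_of_isCatenaryRing {c : SaturatedChain (PrimeSpectrum S)}
    (h0 : c.head.asIdeal ∈ minimalPrimes S) : (c.length : ℕ∞) = Order.height c.last := by
  refine c.length_le_height.antisymm (Order.height_le fun s hs ↦ ?_)
  obtain ⟨a, ha0, hal, hsa⟩ := exists_saturatedChain_of_ltSeries s
  obtain ⟨b, hb0, hbl⟩ := exists_saturatedChain_minimalPrimes s.head
  obtain ⟨d, hd0, hdl⟩ := exists_saturatedChain_closedPoint c.last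
  have hbad := length_eq_ringKrullDim_of_isCatenaryRing hc he
    (c := (b.smash a (hbl.trans ha0.symm)).smash d (by simp [hal, hs, hd0]))
    (by simpa using hb0) (by simp [hdl])
  have hcd := length_eq_ringKrullDim_of_isCatenaryRing hc he (c := c.smash d hd0.symm)
    (by simpa using h0) (by simp [hdl])
  have hlen := hbad.trans hcd.symm
  simp only [RelSeries.smash_length] at hlen
  norm_cast at hlen ⊢
  omega

theorem height_eq_height_add_one_of_covBy {p q : PrimeSpectrum S} (hpq : p ⋖ q) :
    q.asIdeal.height = p.asIdeal.height + 1 := by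
  obtain ⟨c, h0, rfl⟩ := exists_saturatedChain_minimalPrimes p
  have hq := length_eq_height_of_isCatenaryRing hc he (c := c.snoc q hpq) (by simpa using h0)
  rw [RelSeries.last_snoc, RelSeries.snoc_length, Nat.cast_add_one,
    length_eq_height_of_isCatenaryRing hc he h0] at hq
  rw [PrimeSpectrum.height_eq_orderHeight, PrimeSpectrum.height_eq_orderHeight, hq]

end PrimeSpectrum

end SaturatedChain

section Cover

variable {S : Type*} [CommRing S] [IsNoetherianRing S]

theorem covBy_of_mem_minimalPrimes {p q : PrimeSpectrum S} {x : S} (hx : x ∉ p.asIdeal)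
    (hq : q.asIdeal ∈ (p.asIdeal ⊔ Ideal.span {x}).minimalPrimes) : p ⋖ q := by
  have hxq : x ∈ q.asIdeal := hq.1.2 (Ideal.mem_sup_right (Ideal.mem_span_singleton_self x))
  refine ⟨lt_of_le_of_ne (le_sup_left.trans hq.1.2) (by rintro rfl; exact hx hxq), ?_⟩
  intro r hpr hrq
  obtain ⟨t, hxt, hpt, htq⟩ := PrimeSpectrum.exist_mem_one_of_mem_two hpr hrq hxq
  exact htq.not_ge (hq.2 ⟨t.isPrime, sup_le hpt.le
    ((Ideal.span_singleton_le_iff_mem _).mpr hxt)⟩ htq.le)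

theorem exists_wcovBy_mem [IsLocalRing S] {f : S} (hf : f ∈ IsLocalRing.maximalIdeal S)
    (p : PrimeSpectrum S) : ∃ q : PrimeSpectrum S, p ⩿ q ∧ f ∈ q.asIdeal := by
  by_cases hfp : f ∈ p.asIdeal
  · exact ⟨p, WCovBy.rfl, hfp⟩
  have hle : p.asIdeal ⊔ Ideal.span {f} ≤ IsLocalRing.maximalIdeal S :=
    sup_le (IsLocalRing.le_maximalIdeal p.isPrime.ne_top)
      ((Ideal.span_singleton_le_iff_mem _).mpr hf)
  obtain ⟨Q, hQ⟩ := Ideal.nonempty_minimalPrimes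
    (ne_top_of_le_ne_top Ideal.IsPrime.ne_top' hle)
  exact ⟨⟨Q, hQ.1.1⟩, (covBy_of_mem_minimalPrimes hfp hQ).wcovBy,
    hQ.1.2 (Ideal.mem_sup_right (Ideal.mem_span_singleton_self f))⟩

end Cover

section Deformation

theorem satisfiesSerre_iff {A : Type*} [CommRing A] {M : Type*} [AddCommGroup M] [Module A M]
    {n : ℕ} : SatisfiesSerre A M n ↔ ∀ (p : Ideal A) [p.IsPrime], min (n : ℕ∞) p.height ≤
      moduleDepth (Localization.AtPrime p) (LocalizedModule p.primeCompl M) := by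
  refine forall₂_congr fun p _ ↦ ?_
  rw [IsLocalization.AtPrime.ringKrullDim_eq_height p (Localization.AtPrime p)]
  exact_mod_cast Iff.rfl

theorem satisfiesSerre_of_quotSMulTop {S : Type u} [CommRing S] [IsLocalRing S]
    [IsNoetherianRing S] (N : Type u) [AddCommGroup N] [Module S N] [Module.Finite S N] {f : S}
    {n : ℕ} (hfm : f ∈ IsLocalRing.maximalIdeal S)
    (hfN : IsSMulRegular N f) (hM : SatisfiesSerre (S ⧸ Ideal.span {f}) (QuotSMulTop f N) n) :
    SatisfiesSerre S N n := by
  rw [satisfiesSerre_iff] at hM ⊢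
  intro P hP
  obtain ⟨⟨Q, _⟩, hPQ, hfQ⟩ := exists_wcovBy_mem hfm ⟨P, hP⟩
  obtain ⟨q, _, _⟩ := exists_isPrime_liesOver_quotient_span_singleton Q hfQ
  have hdepthQ := moduleDepth_localizedModule_add_one_le_of_liesOver N Q q hfN
  have hQq : Q.height ≤ q.height + 1 := height_le_height_add_one_of_liesOver Q q
  rcases hPQ.covBy_or_eq with hPQ | hPQ
  · have hPq : P.height ≤ q.height := (ENat.add_le_add_iff_right ENat.one_ne_top).mp <|
      (Ideal.height_add_one_le_of_lt_of_isPrime hPQ.lt).trans hQq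
    refine (ENat.add_le_add_iff_right ENat.one_ne_top).mp <| calc
      min (n : ℕ∞) P.height + 1 ≤ min (n : ℕ∞) q.height + 1 := by gcongr
      _ ≤ _ := add_le_add_left (hM q) 1
      _ ≤ _ := hdepthQ
      _ ≤ _ := moduleDepth_localizedModule_le_add_one_of_covBy N hPQ
  · obtain rfl : P = Q := congrArg (·.asIdeal) hPQ
    calc min (n : ℕ∞) P.height ≤ min (n : ℕ∞) (q.height + 1) := by gcongr
      _ ≤ min (n + 1 : ℕ∞) (q.height + 1) := by gcongr; exact le_self_add
      _ = min (n : ℕ∞) q.height + 1 := min_add_add_right _ _ _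
      _ ≤ _ := add_le_add_left (hM q) 1
      _ ≤ _ := hdepthQ

variable {S : Type*} [CommRing S] [IsLocalRing S] [IsNoetherianRing S]
  (N : Type*) [AddCommGroup N] [Module S N] [Module.Finite S N] {f : S} {n : ℕ}

theorem isFreeInCodimension_of_quotSMulTop (hfm : f ∈ IsLocalRing.maximalIdeal S)
    (hfS : IsSMulRegular S f) (hfN : IsSMulRegular N f)
    (hM : IsFreeInCodimension (S ⧸ Ideal.span {f}) (QuotSMulTop f N) n) :
    IsFreeInCodimension S N n := by
  intro P hP hdim
  obtain ⟨Q, _, hPQ, hfQ, hdimQ⟩ :=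
    exists_isPrime_ringKrullDim_quotient_le_add_one hfm hP.ne_top
  obtain ⟨q, _, _⟩ := exists_isPrime_liesOver_quotient_span_singleton Q hfQ
  have hdimR : ringKrullDim (S ⧸ Ideal.span {f}) + 1 ≤ ringKrullDim S :=
    ringKrullDim_quotient_succ_le_of_nonZeroDivisor (mem_nonZeroDivisors_of_isSMulRegular hfS)
  have := hM q <| ENat.WithBot.add_le_add_one_right_iff.mp <| calc
    ringKrullDim (S ⧸ Ideal.span {f}) + 1
      ≤ ringKrullDim (S ⧸ P) + n := hdimR.trans hdim
    _ ≤ ringKrullDim (S ⧸ Q) + 1 + n := by gcongr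
    _ = ringKrullDim ((S ⧸ Ideal.span {f}) ⧸ q) + n + 1 := by
      rw [ringKrullDim_quotient_eq_of_surjective Ideal.Quotient.mk_surjective Q q, add_right_comm]
  have := free_localizedModule_of_liesOver N Q q hfN
  exact free_localizedModule_of_le N hPQ

theorem isFreeUpToHeight_of_quotSMulTop (hfm : f ∈ IsLocalRing.maximalIdeal S)
    (hfS : IsSMulRegular S f) (hfN : IsSMulRegular N f)
    (hc : IsCatenaryRing S) (he : IsEquidimensionalRing S)
    (hM : IsFreeUpToHeight (S ⧸ Ideal.span {f}) (QuotSMulTop f N) n) :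
    IsFreeUpToHeight S N n := by
  intro P hP hht
  obtain ⟨⟨Q, _⟩, hPQ, hfQ⟩ := exists_wcovBy_mem hfm ⟨P, hP⟩
  have hQP : Q.height ≤ P.height + 1 := by
    rcases hPQ.covBy_or_eq with hPQ | hPQ
    · exact (height_eq_height_add_one_of_covBy hc he hPQ).le
    · exact (congrArg (·.asIdeal.height) hPQ).ge.trans le_self_add
  obtain ⟨q, _, _⟩ := exists_isPrime_liesOver_quotient_span_singleton Q hfQ
  have := hM q <| (ENat.add_le_add_iff_right ENat.one_ne_top).mp <| calc
    q.height + 1 ≤ Q.height := height_add_one_le_of_liesOver Q q hfS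
    _ ≤ P.height + 1 := hQP
    _ ≤ n + 1 := by gcongr
  have := free_localizedModule_of_liesOver N Q q hfN
  exact free_localizedModule_of_le N hPQ.le

end Deformation

section ExtOne

open CategoryTheory CategoryTheory.Abelian

theorem subsingleton_ext_one_iff {A : Type u} [CommRing A] {Z F L : Type u} (K : Type u)
    [AddCommGroup Z] [Module A Z] [AddCommGroup F] [Module A F] [Module.Projective A F]
    [AddCommGroup L] [Module A L] [AddCommGroup K] [Module A K] {ι : Z →ₗ[A] F} {π : F →ₗ[A] L}
    (hι : Function.Injective ι) (hex : Function.Exact ι π) (hπ : Function.Surjective π) :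
    Subsingleton (Ext (ModuleCat.of A L) (ModuleCat.of A K) 1) ↔
      ∀ φ : Z →ₗ[A] K, ∃ ψ : F →ₗ[A] K, ψ ∘ₗ ι = φ := by
  have hS : (ModuleCat.shortComplexOfCompEqZero ι π hex.linearMap_comp_eq_zero).ShortExact :=
    ModuleCat.shortComplex_shortExact _ hex hι hπ
  have : CategoryTheory.Projective
      (ModuleCat.shortComplexOfCompEqZero ι π hex.linearMap_comp_eq_zero).X₂ :=
    inferInstanceAs (CategoryTheory.Projective (ModuleCat.of A F))
  constructor
  · intro h φ
    obtain ⟨y, hy⟩ := Ext.contravariant_sequence_exact₁ hS (ModuleCat.of A K)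
      (Ext.mk₀ (ModuleCat.ofHom φ)) (add_comm 1 0) (h.elim _ _)
    obtain ⟨ψ, rfl⟩ := (Ext.mk₀_bijective _ _).2 y
    rw [Ext.mk₀_comp_mk₀] at hy
    exact ⟨ψ.hom, congrArg ModuleCat.Hom.hom ((Ext.mk₀_bijective _ _).1 hy)⟩
  · intro h
    refine subsingleton_of_forall_eq 0 fun x ↦ ?_
    obtain ⟨y, rfl⟩ := Ext.contravariant_sequence_exact₃ hS (ModuleCat.of A K) x
      (Ext.eq_zero_of_projective _) (add_comm 1 0)
    obtain ⟨φ, rfl⟩ := (Ext.mk₀_bijective _ _).2 y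
    obtain ⟨ψ, hψ⟩ := h φ.hom
    obtain rfl : ModuleCat.ofHom ι ≫ ModuleCat.ofHom ψ = φ := ModuleCat.hom_ext hψ
    rw [← Ext.mk₀_comp_mk₀]
    exact hS.extClass_comp_assoc _

section ChangeOfRings

theorem injective_quotSMulTop_map {S Z F N : Type*} [CommRing S] [AddCommGroup Z] [Module S Z]
    [AddCommGroup F] [Module S F] [AddCommGroup N] [Module S N] {f : S} {ι : Z →ₗ[S] F}
    {π : F →ₗ[S] N} (hN : IsSMulRegular N f) (hι : Function.Injective ι)
    (hex : Function.Exact ι π) :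
    Function.Injective (QuotSMulTop.map f ι) := by
  have h := QuotSMulTop.map_first_exact_on_four_term_exact_of_isSMulRegular_last
    ((LinearMap.exact_zero_iff_injective Z ι).mpr hι) hex hN
  rw [map_zero] at h
  exact (LinearMap.exact_zero_iff_injective (QuotSMulTop f Z) _).mp h

variable {S : Type u} [CommRing S] {f : S} {N : Type u} [AddCommGroup N] [Module S N]
  (L : Type u) [AddCommGroup L] [Module S L] [Module (S ⧸ Ideal.span {f}) L]
  [IsScalarTower S (S ⧸ Ideal.span {f}) L]

theorem exists_comp_eq_of_subsingleton_ext_quotSMulTop {Z F : Type u}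
    [AddCommGroup Z] [Module S Z] [AddCommGroup F] [Module S F] [Module.Projective S F]
    {ι : Z →ₗ[S] F} {π : F →ₗ[S] N} (hN : IsSMulRegular N f) (hι : Function.Injective ι)
    (hex : Function.Exact ι π) (hπ : Function.Surjective π)
    (h : Subsingleton (Ext (ModuleCat.of (S ⧸ Ideal.span {f}) (QuotSMulTop f N))
      (ModuleCat.of (S ⧸ Ideal.span {f}) L) 1)) (φ : Z →ₗ[S] L) :
    ∃ ψ : F →ₗ[S] L, ψ ∘ₗ ι = φ := by
  have hS : Function.Surjective (algebraMap S (S ⧸ Ideal.span {f})) := Ideal.Quotient.mk_surjective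
  let hZ := isBaseChange_mkQ_smul_top Z f
  let ι' := (QuotSMulTop.map f ι).extendScalarsOfSurjective hS
  let π' := (QuotSMulTop.map f π).extendScalarsOfSurjective hS
  have hι' : Function.Injective ι' := fun _ _ hxy ↦ injective_quotSMulTop_map hN hι hex hxy
  have hex' : Function.Exact ι' π' := fun x ↦ QuotSMulTop.map_exact f hex hπ x
  have hπ' : Function.Surjective π' := fun x ↦ QuotSMulTop.map_surjective f hπ x
  have : Module.Projective (S ⧸ Ideal.span {f}) (QuotSMulTop f F) :=
    .of_equiv (isBaseChange_mkQ_smul_top F f).equiv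
  obtain ⟨ψ, hψ⟩ := (subsingleton_ext_one_iff L hι' hex' hπ').mp h (hZ.lift φ)
  refine ⟨ψ.restrictScalars S ∘ₗ (f • ⊤ : Submodule S F).mkQ, LinearMap.ext fun z ↦ ?_⟩
  exact (LinearMap.congr_fun hψ (Submodule.Quotient.mk z)).trans (hZ.lift_eq φ z)

theorem subsingleton_ext_one_of_quotSMulTop (hN : IsSMulRegular N f)
    (h : Subsingleton (Ext (ModuleCat.of (S ⧸ Ideal.span {f}) (QuotSMulTop f N))
      (ModuleCat.of (S ⧸ Ideal.span {f}) L) 1)) :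
    Subsingleton (Ext (ModuleCat.of S N) (ModuleCat.of S L) 1) := by
  let π := Finsupp.linearCombination S (id : N → N)
  have hπ : Function.Surjective π := Finsupp.linearCombination_id_surjective S N
  have hι : Function.Injective (LinearMap.ker π).subtype := Subtype.val_injective
  have hex : Function.Exact (LinearMap.ker π).subtype π := LinearMap.exact_subtype_ker_map π
  refine (subsingleton_ext_one_iff (Z := LinearMap.ker π) (F := N →₀ S) L hι hex hπ).mpr ?_
  exact exists_comp_eq_of_subsingleton_ext_quotSMulTop (Z := LinearMap.ker π) (F := N →₀ S) L hN hι
    hex hπ h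

end ChangeOfRings

end ExtOne

section HomReduction

variable {S : Type*} [CommRing S] (f : S) (N K : Type*) [AddCommGroup N] [Module S N]
  [AddCommGroup K] [Module S K]

/-- Reduction of linear maps modulo `f`, as the natural map of `S / (f)`-modules
`Hom_S(N, K) / f Hom_S(N, K) → Hom_{S / (f)}(N / f N, K / f K)`. -/
noncomputable def homReduction : QuotSMulTop f (N →ₗ[S] K) →ₗ[S ⧸ Ideal.span {f}]
    QuotSMulTop f N →ₗ[S ⧸ Ideal.span {f}] QuotSMulTop f K :=
  (isBaseChange_mkQ_smul_top (N →ₗ[S] K) f).lift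
    ((LinearMap.extendScalarsOfSurjectiveEquiv Ideal.Quotient.mk_surjective).toLinearMap ∘ₗ
      QuotSMulTop.map f)

variable {f N K}

theorem homReduction_mk_mk (φ : N →ₗ[S] K) (x : N) :
    homReduction f N K (Submodule.Quotient.mk φ) (Submodule.Quotient.mk x) =
      Submodule.Quotient.mk (φ x) :=
  LinearMap.congr_fun ((isBaseChange_mkQ_smul_top (N →ₗ[S] K) f).lift_eq _ φ)
    (Submodule.Quotient.mk x)

theorem exists_smul_eq_linearMap (hK : IsSMulRegular K f) (φ : N →ₗ[S] K)
    (h : ∀ x, φ x ∈ f • (⊤ : Submodule S K)) : ∃ ψ : N →ₗ[S] K, f • ψ = φ := by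
  let e := LinearEquiv.ofInjective (LinearMap.lsmul S K f) hK
  have hφ (x : N) : φ x ∈ LinearMap.range (LinearMap.lsmul S K f) := by
    obtain ⟨y, -, hy⟩ := h x
    exact ⟨y, hy⟩
  exact ⟨e.symm ∘ₗ φ.codRestrict _ hφ, LinearMap.ext fun x ↦
    congrArg Subtype.val (e.apply_symm_apply (φ.codRestrict _ hφ x))⟩

theorem homReduction_injective (hK : IsSMulRegular K f) :
    Function.Injective (homReduction f N K) := by
  refine (injective_iff_map_eq_zero _).mpr fun φ hφ ↦ ?_
  obtain ⟨φ, rfl⟩ := Submodule.Quotient.mk_surjective _ φ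
  obtain ⟨ψ, rfl⟩ := exists_smul_eq_linearMap hK φ fun x ↦ by
    rw [← Submodule.Quotient.mk_eq_zero, ← homReduction_mk_mk, hφ, LinearMap.zero_apply]
  exact (Submodule.Quotient.mk_eq_zero _).mpr (Submodule.smul_mem_pointwise_smul ψ f ⊤ trivial)

end HomReduction

section HomReductionSurjective

open CategoryTheory CategoryTheory.Abelian

theorem homReduction_surjective {S : Type u} [CommRing S] {f : S} {N K : Type u}
    [AddCommGroup N] [Module S N] [AddCommGroup K] [Module S K] (hK : IsSMulRegular K f)
    (hext : Subsingleton (Ext (ModuleCat.of S N) (ModuleCat.of S K) 1)) :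
    Function.Surjective (homReduction f N K) := by
  intro g
  have hS : ((ModuleCat.of S K).smulShortComplex f).ShortExact := hK.smulShortComplex_shortExact
  let g' : N →ₗ[S] QuotSMulTop f K := g.restrictScalars S ∘ₗ (f • ⊤ : Submodule S N).mkQ
  obtain ⟨y, hy⟩ := Ext.covariant_sequence_exact₃ (ModuleCat.of S N) hS
    (Ext.mk₀ (ModuleCat.ofHom g')) (zero_add 1) (hext.elim _ _)
  obtain ⟨φ, rfl⟩ := (Ext.mk₀_bijective _ _).2 y
  rw [Ext.mk₀_comp_mk₀] at hy
  have hφ := congrArg ModuleCat.Hom.hom ((Ext.mk₀_bijective _ _).1 hy)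
  refine ⟨Submodule.Quotient.mk φ.hom, LinearMap.ext fun x ↦ ?_⟩
  obtain ⟨x, rfl⟩ := Submodule.Quotient.mk_surjective _ x
  exact (homReduction_mk_mk φ.hom x).trans (LinearMap.congr_fun hφ x)

end HomReductionSurjective

theorem mainTheorem10 {S : Type u} [CommRing S] [IsLocalRing S] [IsNoetherianRing S]
    (N : Type u) [AddCommGroup N] [Module S N] [Module.Finite S N]
    (f : S) (hfm : f ∈ IsLocalRing.maximalIdeal S)
    (hfS : IsSMulRegular S f) (hfN : IsSMulRegular N f) :
    (∀ n : ℕ, IsFreeInCodimension (S ⧸ Ideal.span {f}) (QuotSMulTop f N) n →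
      IsFreeInCodimension S N n) ∧
    (IsCatenaryRing S → IsEquidimensionalRing S →
      ∀ n : ℕ, IsFreeUpToHeight (S ⧸ Ideal.span {f}) (QuotSMulTop f N) n →
        IsFreeUpToHeight S N n) ∧
    (∀ n : ℕ, SatisfiesSerre (S ⧸ Ideal.span {f}) (QuotSMulTop f N) n →
      SatisfiesSerre S N n) ∧
    (∀ (K : Type u) [AddCommGroup K] [Module S K] [Module.Finite S K],
      IsSMulRegular K f →
      Subsingleton (CategoryTheory.Abelian.Ext
        (ModuleCat.of (S ⧸ Ideal.span {f}) (QuotSMulTop f N))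
        (ModuleCat.of (S ⧸ Ideal.span {f}) (QuotSMulTop f K)) 1) →
      Subsingleton (CategoryTheory.Abelian.Ext (ModuleCat.of S N) (ModuleCat.of S K) 1) ∧
      ∃ e : QuotSMulTop f (N →ₗ[S] K) ≃ₗ[S ⧸ Ideal.span {f}]
          (QuotSMulTop f N →ₗ[S ⧸ Ideal.span {f}] QuotSMulTop f K),
        ∀ (φ : N →ₗ[S] K) (x : N),
          e (Submodule.Quotient.mk φ) (Submodule.Quotient.mk x) =
            Submodule.Quotient.mk (φ x)) := by
  refine ⟨fun n ↦ isFreeInCodimension_of_quotSMulTop N hfm hfS hfN,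
    fun hc he n ↦ isFreeUpToHeight_of_quotSMulTop N hfm hfS hfN hc he,
    fun n ↦ satisfiesSerre_of_quotSMulTop N hfm hfN, fun K _ _ _ hfK hextR ↦ ?_⟩
  have hext : Subsingleton
      (CategoryTheory.Abelian.Ext (ModuleCat.of S N) (ModuleCat.of S K) 1) :=
    subsingleton_ext_of_quotSMulTop_right (IsLocalRing.maximalIdeal_le_jacobson _ hfm) hfK 1
      (subsingleton_ext_one_of_quotSMulTop (QuotSMulTop f K) hfN hextR)
  exact ⟨hext, LinearEquiv.ofBijective (homReduction f N K)
    ⟨homReduction_injective hfK, homReduction_surjective hfK hext⟩, homReduction_mk_mk⟩
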